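/- Conventions. Categories are small and products are written in the order of the arrows, so $ab$ is defined when the codomain of $a$ is the domain of $b$. A category $C$ is *left cancellative* if $ax=ay$ implies $x=y$, *right cancellative* if $xa=ya$ implies $x=y$, and *right rigid* if $aC\cap bC\neq\emptyset$ implies $aC\subseteq bC$ or $bC\subseteq aC$, where $aC=\{ab : ab \text{ is defined}\}$. A *left Rees category* is a left cancellative, right rigid category in which every principal right ideal $aC$ is properly contained in only finitely many distinct principal right ideals. A *Rees category* is a left Rees category that is also right cancellative. A category is *skeletal* if isomorphic objects are equal. A *diagram of partial homomorphisms* $D$ consists of a directed graph, a group $G_e$ for each vertex $e$, and, for each edge $x\colon e\to f$, a surjective homomorphism $\phi_x\colon (G_e)^+_x\to (G_f)^-_x$ between subgroups $(G_e)^+_x\le G_e$ and $(G_f)^-_x\le G_f$. It is a *diagram of partial isomorphisms* if every $\phi_x$ is an isomorphism. *The category $\langle D\rangle$.* Let $D'$ be the directed graph obtained from $D$ by adjoining, at each vertex $e$, one loop for each element of $G_e$. Then $\langle D\rangle$ is the quotient of the free category on $D'$ by the congruence generated by the relations $g\cdot h=gh$ for $g,h\in G_e$; $1_{G_e}=1_e$,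 identifying the loop of the identity element of $G_e$ with the identity arrow at $e$; and $g\cdot x=x\cdot\phi_x(g)$ for each edge $x\colon e\to f$ and each $g\in (G_e)^+_x$. *The bimodule $\mathsf B(D)$.* Let $G=\bigsqcup_e G_e$, regarded as a groupoid whose objects are the vertices. A $(G,G)$-bimodule is a set with source and target maps to the objects of $G$ and with commuting left and right actions of $G$; it is a *covering bimodule* if its right action is free, that is, $xg=x$ only if $g$ is an identity. The covering bimodule $\mathsf B(D)$ is the set of classes $[g,x,h]$ of triples with $x\colon e\to f$ an edge, $g\in G_e$ and $h\in G_f$, where $[g_1,x_1,h_1]=[g_2,x_2,h_2]$ if and only if $x_1=x_2=x$, $g_2^{-1}g_1\in(G_e)^+_x$ and $\phi_x(g_2^{-1}g_1)=h_2h_1^{-1}$; the actions are $g[g_1,x,h_1]=[gg_1,x,h_1]$ and $[g_1,x,h_1]h=[g_1,x,h_1h]$. *The tensor category.* For a $(G,G)$-bimodule $X$, the tensor product $X\otimes Y$ with a $(G,G)$-bimodule $Y$ is the set of pairs $(x,y)$, with the target of $x$ equal to the source of $y$, modulo $(x,y)\sim(xg^{-1},gy)$ for $g\in G$. The tensor category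 $\mathsf T(X)=\bigsqcup_{n\ge 0}X^{\otimes n}$, where $X^{\otimes 0}=G$ and $X^{\otimes 1}=X$, has the objects of $G$ as its objects, and its multiplication is given by concatenation of tensors, by the two actions of $G$, and by multiplication in $G$. **Theorem (Presentation theorem).** Let $D$ be a diagram of partial homomorphisms. Then $\langle D\rangle$ is a skeletal left Rees category, and it is isomorphic to the tensor category $\mathsf T(\mathsf B(D))$. Moreover, $\langle D\rangle$ is a skeletal Rees category if and only if $D$ is a diagram of partial isomorphisms. -/

import Mathlib

open CategoryTheory

universe u

/-! ### Left Rees categories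

Products are written in the order of the arrows: `ab` is `a ≫ b`. -/

namespace ReesCat

section Categories

variable (C : Type u) [Category.{u} C]

/-- `ax = ay` implies `x = y`. -/
def LeftCancellative : Prop :=
  ∀ ⦃X Y Z : C⦄ (a : X ⟶ Y) (x y : Y ⟶ Z), a ≫ x = a ≫ y → x = y

/-- `xa = ya` implies `x = y`. -/
def RightCancellative : Prop :=
  ∀ ⦃X Y Z : C⦄ (x y : X ⟶ Y) (a : Y ⟶ Z), x ≫ a = y ≫ a → x = y

variable {C} in
/-- The principal right ideal `aC`, as a set of arrows of `C`. -/
def principalRightIdeal {X Y : C} (a : X ⟶ Y) : Set (Arrow C) :=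
  {c | ∃ (Z : C) (b : Y ⟶ Z), c = Arrow.mk (a ≫ b)}

/-- If `aC ∩ bC` is nonempty then `aC ⊆ bC` or `bC ⊆ aC`. -/
def RightRigid : Prop :=
  ∀ ⦃X Y X' Y' : C⦄ (a : X ⟶ Y) (b : X' ⟶ Y'),
    (principalRightIdeal a ∩ principalRightIdeal b).Nonempty →
      principalRightIdeal a ⊆ principalRightIdeal b ∨
        principalRightIdeal b ⊆ principalRightIdeal a

/-- A left Rees category: left cancellative, right rigid, and each principal right ideal is
properly contained in only finitely many distinct principal right ideals. -/
structure IsLeftRees : Prop where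
  leftCancellative : LeftCancellative C
  rightRigid : RightRigid C
  finite_above : ∀ ⦃X Y : C⦄ (a : X ⟶ Y),
    {I : Set (Arrow C) | (∃ (X' Y' : C) (b : X' ⟶ Y'), I = principalRightIdeal b) ∧
      principalRightIdeal a ⊂ I}.Finite

/-- A Rees category: a left Rees category that is also right cancellative. -/
structure IsRees : Prop extends IsLeftRees C where
  rightCancellative : RightCancellative C

/-- Isomorphism (not merely equivalence) of categories. -/
def IsomorphicCategories (C D : Type u) [Category.{u} C] [Category.{u} D] : Prop :=
  ∃ (F : C ⥤ D) (F' : D ⥤ C), F ⋙ F' = 𝟭 C ∧ F' ⋙ F = 𝟭 D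

end Categories

/-! ### Bimodules over a groupoid -/

/-- A `(G, G)`-bimodule. `Elt e f` is the set of elements `x` with `s(x) = e` and `t(x) = f`. -/
structure Bimodule (G : Type u) [Groupoid.{u} G] where
  Elt : G → G → Type u
  lact : ∀ {e' e f : G}, (e' ⟶ e) → Elt e f → Elt e' f
  ract : ∀ {e f f' : G}, Elt e f → (f ⟶ f') → Elt e f'
  id_lact : ∀ {e f : G} (x : Elt e f), lact (𝟙 e) x = x
  comp_lact : ∀ {e₁ e₂ e f : G} (g : e₁ ⟶ e₂) (h : e₂ ⟶ e) (x : Elt e f),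
    lact (g ≫ h) x = lact g (lact h x)
  ract_id : ∀ {e f : G} (x : Elt e f), ract x (𝟙 f) = x
  ract_comp : ∀ {e f f₁ f₂ : G} (x : Elt e f) (g : f ⟶ f₁) (h : f₁ ⟶ f₂),
    ract x (g ≫ h) = ract (ract x g) h
  lact_ract : ∀ {e' e f f' : G} (g : e' ⟶ e) (x : Elt e f) (h : f ⟶ f'),
    ract (lact g x) h = lact g (ract x h)

/-- A covering bimodule: a bimodule whose right action is free. -/
structure CoveringBimodule (G : Type u) [Groupoid.{u} G] extends Bimodule G where
  right_free : ∀ {e f : G} (x : Elt e f) (g : f ⟶ f), ract x g = x → g = 𝟙 f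

namespace Bimodule

variable {G : Type u} [Groupoid.{u} G]

/-- `G` acting on itself by multiplication on both sides. -/
def unit (G : Type u) [Groupoid.{u} G] : Bimodule G where
  Elt e f := e ⟶ f
  lact g x := g ≫ x
  ract x g := x ≫ g
  id_lact x := Category.id_comp x
  comp_lact g h x := Category.assoc g h x
  ract_id x := Category.comp_id x
  ract_comp x g h := (Category.assoc x g h).symm
  lact_ract g x h := Category.assoc g x h

/-- The part of `X * Y` with source `e` and target `f`: matching pairs `(x, y)`. -/
structure Pair (X Y : Bimodule G) (e f : G) : Type u where
  mid : G
  left : X.Elt e mid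
  right : Y.Elt mid f

/-- `(x, y) ∼ (x', y')` iff `(x', y') = (x g⁻¹, g y)` for some `g` in `G`. -/
instance pairSetoid (X Y : Bimodule G) (e f : G) : Setoid (Pair X Y e f) where
  r p q := ∃ g : q.mid ⟶ p.mid,
    q.left = X.ract p.left (Groupoid.inv g) ∧ q.right = Y.lact g p.right
  iseqv :=
    { refl := fun p => ⟨𝟙 _, by
        constructor
        · rw [Groupoid.inv_eq_inv, IsIso.inv_id, X.ract_id]
        · rw [Y.id_lact]⟩
      symm := by
        rintro p q ⟨g, h₁, h₂⟩
        refine ⟨Groupoid.inv g, ?_, ?_⟩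
        · rw [h₁, ← X.ract_comp]; simp [X.ract_id]
        · rw [h₂, ← Y.comp_lact]; simp [Y.id_lact]
      trans := by
        rintro p q r ⟨g, h₁, h₂⟩ ⟨g', h₁', h₂'⟩
        refine ⟨g' ≫ g, ?_, ?_⟩
        · rw [h₁', h₁, ← X.ract_comp]; simp
        · rw [h₂', h₂, ← Y.comp_lact] }

/-- The tensor product `X ⊗ Y` with `g (x ⊗ y) = gx ⊗ y` and `(x ⊗ y) g = x ⊗ yg`. -/
def tensor (X Y : Bimodule G) : Bimodule G where
  Elt e f := _root_.Quotient (pairSetoid X Y e f)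
  lact g := _root_.Quotient.map (fun p => ⟨p.mid, X.lact g p.left, p.right⟩) (by
    rintro p q ⟨k, h₁, h₂⟩
    exact ⟨k, by simp only [h₁, X.lact_ract], h₂⟩)
  ract t g := _root_.Quotient.map (fun p => ⟨p.mid, p.left, Y.ract p.right g⟩) (by
    rintro p q ⟨k, h₁, h₂⟩
    exact ⟨k, h₁, by simp only [h₂, Y.lact_ract]⟩) t
  id_lact := by
    rintro e f ⟨p⟩
    exact congrArg (fun x => _root_.Quotient.mk (pairSetoid X Y e f) ⟨p.mid, x, p.right⟩)
      (X.id_lact p.left)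
  comp_lact := by
    rintro e₁ e₂ e f g h ⟨p⟩
    exact congrArg (fun x => _root_.Quotient.mk (pairSetoid X Y e₁ f) ⟨p.mid, x, p.right⟩)
      (X.comp_lact g h p.left)
  ract_id := by
    rintro e f ⟨p⟩
    exact congrArg (fun y => _root_.Quotient.mk (pairSetoid X Y e f) ⟨p.mid, p.left, y⟩)
      (Y.ract_id p.right)
  ract_comp := by
    rintro e f f₁ f₂ ⟨p⟩ g h
    exact congrArg (fun y => _root_.Quotient.mk (pairSetoid X Y e f₂) ⟨p.mid, p.left, y⟩)
      (Y.ract_comp p.right g h)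
  lact_ract := by rintro e' e f f' g ⟨p⟩ h; rfl

/-- The element `x ⊗ y`. -/
def tmul {X Y : Bimodule G} {e m f : G} (x : X.Elt e m) (y : Y.Elt m f) :
    (X.tensor Y).Elt e f :=
  _root_.Quotient.mk (pairSetoid X Y e f) ⟨m, x, y⟩

theorem tmul_ract {X Y : Bimodule G} {e m m' f : G} (x : X.Elt e m) (g : m ⟶ m')
    (y : Y.Elt m' f) : tmul (X.ract x g) y = tmul x (Y.lact g y) :=
  _root_.Quotient.sound (s := pairSetoid X Y e f) ⟨g, by
    change x = X.ract (X.ract x g) (Groupoid.inv g)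
    rw [← X.ract_comp]; simp [X.ract_id], rfl⟩

/-- The tensor powers: `X^{⊗0} = G`, `X^{⊗1} = X`, `X^{⊗(n+2)} = X ⊗ X^{⊗(n+1)}`. -/
def tpow (X : Bimodule G) : ℕ → Bimodule G
  | 0 => unit G
  | 1 => X
  | n + 2 => X.tensor (X.tpow (n + 1))

/-- Elements of `T(X)`, the disjoint union of all `X^{⊗n}`, from `e` to `f`. -/
def THom (X : Bimodule G) (e f : G) : Type u := Σ n : ℕ, (X.tpow n).Elt e f

namespace THom

variable {X : Bimodule G}

/-- The left action of `G` on `T(X)`. -/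
def glact {e' e f : G} (g : e' ⟶ e) (t : X.THom e f) : X.THom e' f :=
  ⟨t.1, (X.tpow t.1).lact g t.2⟩

/-- The product of `x ∈ X` and `t ∈ T(X)`: it is `xg` if `t = g ∈ G`, and `x ⊗ t` otherwise. -/
def cons {e m f : G} (x : X.Elt e m) : X.THom m f → X.THom e f
  | ⟨0, g⟩ => ⟨1, X.ract x g⟩
  | ⟨n + 1, t⟩ => ⟨n + 2, tmul x t⟩

theorem cons_ract {e m m' f : G} (x : X.Elt e m) (g : m ⟶ m') (t : X.THom m' f) :
    cons (X.ract x g) t = cons x (glact g t) := by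
  rcases t with ⟨_ | n, t⟩
  · exact congrArg (Sigma.mk 1) (X.ract_comp x g t).symm
  · exact congrArg (Sigma.mk (n + 2)) (tmul_ract x g t)

theorem cons_lact {e' e m f : G} (g : e' ⟶ e) (x : X.Elt e m) (t : X.THom m f) :
    cons (X.lact g x) t = glact g (cons x t) := by
  rcases t with ⟨_ | n, t⟩
  · exact congrArg (Sigma.mk 1) (X.lact_ract g x t)
  · rfl

theorem id_glact {e f : G} (t : X.THom e f) : glact (𝟙 e) t = t :=
  congrArg (Sigma.mk t.1) ((X.tpow t.1).id_lact t.2)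

theorem comp_glact {e₁ e₂ e f : G} (g : e₁ ⟶ e₂) (h : e₂ ⟶ e) (t : X.THom e f) :
    glact (g ≫ h) t = glact g (glact h t) :=
  congrArg (Sigma.mk t.1) ((X.tpow t.1).comp_lact g h t.2)

/-- Right multiplication `t ↦ t · s` on each `X^{⊗n}`, with the fact that it commutes with the
left action of `G`. For `n = 0` it is the left action, for `n = 1` it is `cons`, and
`(x ⊗ t) · s` is `x` times `t · s`. -/
def mulAux {m f : G} (s : X.THom m f) : ∀ n : ℕ,
    {F : ∀ e : G, (X.tpow n).Elt e m → X.THom e f //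
      ∀ (e' e : G) (g : e' ⟶ e) (t : (X.tpow n).Elt e m),
        F e' ((X.tpow n).lact g t) = glact g (F e t)}
  | 0 => ⟨fun _ g => glact g s, fun _ _ g h => comp_glact g h s⟩
  | 1 => ⟨fun _ x => cons x s, fun _ _ g x => cons_lact g x s⟩
  | n + 2 =>
    ⟨fun e => _root_.Quotient.lift
        (fun p : Pair X (X.tpow (n + 1)) e m =>
          cons p.left ((mulAux s (n + 1)).1 p.mid p.right))
        (by
          rintro ⟨a, x, y⟩ ⟨b, x', y'⟩ ⟨g, h₁, h₂⟩
          dsimp only at g h₁ h₂ ⊢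
          rw [h₁, h₂, (mulAux s (n + 1)).2, cons_ract, ← comp_glact]
          simp [id_glact]),
      by
        rintro e' e g ⟨p⟩
        exact cons_lact g p.left _⟩

/-- Multiplication in `T(X)`. -/
def mul {e m f : G} (t : X.THom e m) (s : X.THom m f) : X.THom e f :=
  (mulAux s t.1).1 e t.2

theorem glact_mul {e' e m f : G} (g : e' ⟶ e) (t : X.THom e m) (s : X.THom m f) :
    mul (glact g t) s = glact g (mul t s) :=
  (mulAux s t.1).2 e' e g t.2

theorem cons_mul {e k m f : G} (x : X.Elt e k) (t : X.THom k m) (s : X.THom m f) :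
    mul (cons x t) s = cons x (mul t s) := by
  rcases t with ⟨_ | n, t⟩
  · exact cons_ract x t s
  · rfl

theorem mul_one {e f : G} (t : X.THom e f) : mul t ⟨0, 𝟙 f⟩ = t := by
  rcases t with ⟨n, t⟩
  induction n generalizing e with
  | zero => exact congrArg (Sigma.mk 0) (Category.comp_id (X := e) t)
  | succ n ih =>
    cases n with
    | zero => exact congrArg (Sigma.mk 1) (X.ract_id t)
    | succ n =>
      rcases t with ⟨p⟩
      exact congrArg (cons p.left) (ih p.right)

theorem mul_assoc {e k m f : G} (t : X.THom e k) (s : X.THom k m) (r : X.THom m f) :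
    mul (mul t s) r = mul t (mul s r) := by
  rcases t with ⟨n, t⟩
  induction n generalizing e with
  | zero => exact glact_mul t s r
  | succ n ih =>
    cases n with
    | zero => exact cons_mul t s r
    | succ n =>
      rcases t with ⟨p⟩
      exact (cons_mul p.left (mul ⟨n + 1, p.right⟩ s) r).trans
        (congrArg (cons p.left) (ih p.right))

end THom

/-- The (objects of the) tensor category `T(X)` of the bimodule `X`. -/
def TensorCategory (_X : Bimodule G) : Type u := G

instance (X : Bimodule G) : Category.{u} X.TensorCategory where
  Hom e f := X.THom e f
  id e := ⟨0, CategoryStruct.id (obj := G) e⟩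
  comp t s := THom.mul t s
  id_comp t := THom.id_glact t
  comp_id t := THom.mul_one t
  assoc t s r := THom.mul_assoc t s r

end Bimodule

/-! ### Diagrams of partial homomorphisms -/

/-- A diagram of partial homomorphisms: a directed graph, a group at each vertex, and for each
edge `x : e → f` a surjective homomorphism `φ_x` from a subgroup of the group at `e` onto a
subgroup of the group at `f`. -/
structure PartialHomDiagram where
  V : Type u
  Edge : V → V → Type u
  Grp : V → Type u
  [group : ∀ e, Group (Grp e)]
  dom : ∀ {e f : V}, Edge e f → Subgroup (Grp e)
  cod : ∀ {e f : V}, Edge e f → Subgroup (Grp f)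
  φ : ∀ {e f : V} (x : Edge e f), dom x →* cod x
  φ_surjective : ∀ {e f : V} (x : Edge e f), Function.Surjective (φ x)

namespace PartialHomDiagram

attribute [instance] PartialHomDiagram.group

variable (D : PartialHomDiagram.{u})

/-- A diagram of partial isomorphisms: every `φ_x` is an isomorphism. -/
def IsPartialIso : Prop :=
  ∀ ⦃e f : D.V⦄ (x : D.Edge e f), Function.Bijective (D.φ x)

/-! #### The covering bimodule of a diagram -/

/-- Arrows of the disjoint union of the vertex groups. -/
inductive Loop : D.V → D.V → Type u
  | mk {e : D.V} (g : D.Grp e) : Loop e e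

/-- The (objects of the) disjoint union of the vertex groups, regarded as a groupoid. -/
def VertexGroupoid : Type u := D.V

/-- The identity of the vertex group at `e`. -/
def loopOne (e : D.V) : D.Loop e e := Loop.mk 1

/-- Products in the vertex groups. -/
def loopMul {e f k : D.V} : D.Loop e f → D.Loop f k → D.Loop e k
  | Loop.mk g, Loop.mk h => Loop.mk (g * h)

/-- Inverses in the vertex groups. -/
def loopInv {e f : D.V} : D.Loop e f → D.Loop f e
  | Loop.mk g => Loop.mk g⁻¹

theorem loopOne_mul {e f : D.V} (a : D.Loop e f) : D.loopMul (D.loopOne e) a = a := by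
  cases a; exact congrArg Loop.mk (one_mul _)

theorem loopMul_one {e f : D.V} (a : D.Loop e f) : D.loopMul a (D.loopOne f) = a := by
  cases a; exact congrArg Loop.mk (mul_one _)

theorem loopMul_assoc {e f k l : D.V} (a : D.Loop e f) (b : D.Loop f k) (c : D.Loop k l) :
    D.loopMul (D.loopMul a b) c = D.loopMul a (D.loopMul b c) := by
  cases a; cases b; cases c; exact congrArg Loop.mk (mul_assoc _ _ _)

theorem loopInv_mul {e f : D.V} (a : D.Loop e f) : D.loopMul (D.loopInv a) a = D.loopOne f := by
  cases a; exact congrArg Loop.mk (inv_mul_cancel _)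

theorem loopMul_inv {e f : D.V} (a : D.Loop e f) : D.loopMul a (D.loopInv a) = D.loopOne e := by
  cases a; exact congrArg Loop.mk (mul_inv_cancel _)

instance : Groupoid.{u} D.VertexGroupoid where
  Hom e f := D.Loop e f
  id e := D.loopOne e
  comp a b := D.loopMul a b
  inv a := D.loopInv a
  id_comp a := D.loopOne_mul a
  comp_id a := D.loopMul_one a
  assoc a b c := D.loopMul_assoc a b c
  inv_comp a := D.loopInv_mul a
  comp_inv a := D.loopMul_inv a

/-- Triples `(g, x, h)` with `x : e → f` an edge, `g ∈ G_e` and `h ∈ G_f`. -/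
structure Triple (e f : D.V) : Type u where
  g : D.Grp e
  x : D.Edge e f
  h : D.Grp f

/-- `(g₁, x₁, h₁) ≡ (g₂, x₂, h₂)` iff `x₁ = x₂ = x`, `g₂⁻¹ g₁` is in the domain of `φ_x` and
`φ_x (g₂⁻¹ g₁) = h₂ h₁⁻¹`. -/
instance tripleSetoid (e f : D.V) : Setoid (D.Triple e f) where
  r p q := p.x = q.x ∧ ∃ hg : q.g⁻¹ * p.g ∈ D.dom p.x,
    (D.φ p.x ⟨q.g⁻¹ * p.g, hg⟩ : D.Grp f) = q.h * p.h⁻¹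
  iseqv :=
    { refl := fun p => ⟨rfl, by simp, by
        have : (⟨p.g⁻¹ * p.g, by simp⟩ : D.dom p.x) = 1 := Subtype.ext (by simp)
        rw [this]; simp⟩
      symm := by
        rintro ⟨g₁, x, h₁⟩ ⟨g₂, _, h₂⟩ ⟨rfl, hg, hφ⟩
        dsimp only at hg hφ
        have hg' : g₁⁻¹ * g₂ ∈ D.dom x := by simpa using inv_mem hg
        refine ⟨rfl, hg', ?_⟩
        have : (⟨g₁⁻¹ * g₂, hg'⟩ : D.dom x) = ⟨g₂⁻¹ * g₁, hg⟩⁻¹ := Subtype.ext (by simp)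
        dsimp only
        rw [this, map_inv, Subgroup.coe_inv, hφ]; simp
      trans := by
        rintro ⟨g₁, x, h₁⟩ ⟨g₂, _, h₂⟩ ⟨g₃, _, h₃⟩ ⟨rfl, hg, hφ⟩ ⟨rfl, hg', hφ'⟩
        dsimp only at hg hφ hg' hφ'
        have hg'' : g₃⁻¹ * g₁ ∈ D.dom x := by simpa [mul_assoc] using mul_mem hg' hg
        refine ⟨rfl, hg'', ?_⟩
        have : (⟨g₃⁻¹ * g₁, hg''⟩ : D.dom x) = ⟨g₃⁻¹ * g₂, hg'⟩ * ⟨g₂⁻¹ * g₁, hg⟩ :=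
          Subtype.ext (by simp [mul_assoc])
        dsimp only
        rw [this, map_mul, Subgroup.coe_mul, hφ, hφ']; simp [mul_assoc] }

/-- `g [g₁, x, h₁] = [g g₁, x, h₁]`. -/
def tripleLact {e' e f : D.V} : D.Loop e' e → _root_.Quotient (D.tripleSetoid e f) →
    _root_.Quotient (D.tripleSetoid e' f)
  | Loop.mk g => _root_.Quotient.map (fun p => ⟨g * p.g, p.x, p.h⟩) (by
      rintro p q ⟨hx, hg, hφ⟩
      have key : (g * q.g)⁻¹ * (g * p.g) = q.g⁻¹ * p.g := by simp [mul_assoc]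
      refine ⟨hx, by simpa only [key] using hg, ?_⟩
      simpa only [key] using hφ)

/-- `[g₁, x, h₁] h = [g₁, x, h₁ h]`. -/
def tripleRact {e f f' : D.V} : _root_.Quotient (D.tripleSetoid e f) → D.Loop f f' →
    _root_.Quotient (D.tripleSetoid e f')
  | t, Loop.mk h => _root_.Quotient.map (fun p => ⟨p.g, p.x, p.h * h⟩) (by
      rintro p q ⟨hx, hg, hφ⟩
      refine ⟨hx, hg, ?_⟩
      rw [hφ]; simp [mul_assoc]) t

theorem tripleLact_one {e f : D.V} (t : _root_.Quotient (D.tripleSetoid e f)) :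
    D.tripleLact (D.loopOne e) t = t := by
  rcases t with ⟨p⟩
  exact congrArg (fun k => _root_.Quotient.mk (D.tripleSetoid e f) ⟨k, p.x, p.h⟩) (one_mul p.g)

theorem tripleLact_mul {e₁ e₂ e f : D.V} (a : D.Loop e₁ e₂) (b : D.Loop e₂ e)
    (t : _root_.Quotient (D.tripleSetoid e f)) :
    D.tripleLact (D.loopMul a b) t = D.tripleLact a (D.tripleLact b t) := by
  rcases t with ⟨p⟩
  cases a; cases b
  exact congrArg (fun k => _root_.Quotient.mk (D.tripleSetoid _ f) ⟨k, p.x, p.h⟩) (mul_assoc _ _ p.g)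

theorem tripleRact_one {e f : D.V} (t : _root_.Quotient (D.tripleSetoid e f)) :
    D.tripleRact t (D.loopOne f) = t := by
  rcases t with ⟨p⟩
  exact congrArg (fun k => _root_.Quotient.mk (D.tripleSetoid e f) ⟨p.g, p.x, k⟩) (mul_one p.h)

theorem tripleRact_mul {e f f₁ f₂ : D.V} (t : _root_.Quotient (D.tripleSetoid e f))
    (a : D.Loop f f₁) (b : D.Loop f₁ f₂) :
    D.tripleRact t (D.loopMul a b) = D.tripleRact (D.tripleRact t a) b := by
  rcases t with ⟨p⟩
  cases a; cases b
  exact congrArg (fun k => _root_.Quotient.mk (D.tripleSetoid e _) ⟨p.g, p.x, k⟩)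
    (mul_assoc p.h _ _).symm

theorem tripleLact_ract {e' e f f' : D.V} (a : D.Loop e' e)
    (t : _root_.Quotient (D.tripleSetoid e f)) (b : D.Loop f f') :
    D.tripleRact (D.tripleLact a t) b = D.tripleLact a (D.tripleRact t b) := by
  rcases t with ⟨p⟩
  cases a; cases b; rfl

theorem tripleRact_free {e f : D.V} (t : _root_.Quotient (D.tripleSetoid e f)) (a : D.Loop f f)
    (h : D.tripleRact t a = t) : a = D.loopOne f := by
  rcases t with ⟨p⟩
  cases a with
  | mk g =>
    obtain ⟨-, hm, hφ⟩ := _root_.Quotient.exact h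
    dsimp only at hm hφ
    have : (⟨p.g⁻¹ * p.g, hm⟩ : D.dom p.x) = 1 := Subtype.ext (by simp)
    rw [this, map_one, OneMemClass.coe_one] at hφ
    have h1 : g = 1 := by simpa using mul_inv_eq_one.mp hφ.symm
    exact congrArg Loop.mk h1

/-- The covering bimodule `B(D)` of the diagram `D`. -/
def coveringBimodule : CoveringBimodule D.VertexGroupoid where
  Elt e f := _root_.Quotient (D.tripleSetoid e f)
  lact a t := D.tripleLact a t
  ract t a := D.tripleRact t a
  id_lact t := D.tripleLact_one t
  comp_lact a b t := D.tripleLact_mul a b t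
  ract_id t := D.tripleRact_one t
  ract_comp t a b := D.tripleRact_mul t a b
  lact_ract a t b := D.tripleLact_ract a t b
  right_free t a h := D.tripleRact_free t a h

/-! #### The category presented by a diagram -/

/-- Edges of the graph `D'`: the edges of `D` and, at each vertex `e`, one loop for each element
of the vertex group at `e`. -/
inductive AugEdge : D.V → D.V → Type u
  | edge {e f : D.V} (x : D.Edge e f) : AugEdge e f
  | loop {e : D.V} (g : D.Grp e) : AugEdge e e

/-- The vertices of the directed graph `D'`. -/
def Aug : Type u := D.V

instance : Quiver D.Aug where
  Hom e f := D.AugEdge e f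

/-- An edge of `D`, as an arrow of the free category on `D'`. -/
def edgeArrow {e f : D.V} (x : D.Edge e f) :
    (Paths.of D.Aug).obj e ⟶ (Paths.of D.Aug).obj f :=
  (Paths.of D.Aug).map (AugEdge.edge x)

/-- An element of a vertex group, as an arrow of the free category on `D'`. -/
def loopArrow {e : D.V} (g : D.Grp e) :
    (Paths.of D.Aug).obj e ⟶ (Paths.of D.Aug).obj e :=
  (Paths.of D.Aug).map (AugEdge.loop g)

/-- The defining relations of `⟨D⟩`. The identity of each vertex group is the identity arrow of
the category at that vertex. -/
inductive Rel : HomRel (Paths D.Aug)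
  | one (e : D.V) : Rel (D.loopArrow (1 : D.Grp e)) (𝟙 ((Paths.of D.Aug).obj e))
  | mul {e : D.V} (g h : D.Grp e) : Rel (D.loopArrow g ≫ D.loopArrow h) (D.loopArrow (g * h))
  | edge {e f : D.V} (x : D.Edge e f) (g : D.dom x) :
      Rel (D.loopArrow (g : D.Grp e) ≫ D.edgeArrow x)
        (D.edgeArrow x ≫ D.loopArrow (D.φ x g : D.Grp f))

/-- The category `⟨D⟩`: the free category on `D'` modulo the congruence generated by the
defining relations. -/
abbrev PresentedCategory : Type u := CategoryTheory.Quotient D.Rel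

end PartialHomDiagram

end ReesCat

/-! The degree in `T(X)` is additive, and `exists_of_cons_eq` plays the part of unique
factorisation: if `x t = x' t'` with `x`, `x'` in `X`, then the two factorisations differ only by
some `g` in `G` inserted between the factors. Peeling off leading factors by `cons_induction`
therefore reduces questions about products to questions about the two actions of `G`. A free right
action gives left cancellation, a free left action gives right cancellation, and right rigidity
needs no freeness at all. Elements of degree zero are invertible, so among the left divisors of an
arrow the degree determines the principal right ideal, and only finitely many ideals lie above a
given one.

The isomorphism of `⟨D⟩` with `T(B(D))` comes from two universal properties: relations define
functors out of `⟨D⟩`, and compatible maps on `G` and `X` define functors out of `T(X)`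
(`Representation.tensorFunctor`). The two functors are mutually inverse because they are so on
generators. The right action on `B(D)` is always free. The left action is free when every `φ_x` is
injective, and conversely a failure of injectivity gives `a x = b x` with `a ≠ b`. -/

namespace ReesCat

/-! ### Factorisation, cancellation and rigidity in `T(X)`. -/

namespace Bimodule.THom

variable {G : Type u} [Groupoid.{u} G] {X : Bimodule G}

/-- The inclusion of `G` into `T(X)`. -/
def ofGroupoid {e f : G} (g : e ⟶ f) : X.THom e f := ⟨0, g⟩

/-- The inclusion of `X` into `T(X)`. -/
def ofElt {e f : G} (x : X.Elt e f) : X.THom e f := ⟨1, x⟩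

theorem mul_ofGroupoid_id {e f : G} (t : X.THom e f) : mul t (ofGroupoid (𝟙 f)) = t := mul_one t

theorem cons_ofGroupoid {e m f : G} (x : X.Elt e m) (g : m ⟶ f) :
    cons x (ofGroupoid g) = ofElt (X.ract x g) := rfl

theorem ofGroupoid_mul {e m f : G} (g : e ⟶ m) (t : X.THom m f) :
    mul (ofGroupoid g) t = glact g t := rfl

theorem ofElt_mul {e m f : G} (x : X.Elt e m) (t : X.THom m f) :
    mul (ofElt x) t = cons x t := rfl

theorem glact_ofGroupoid {e m f : G} (g : e ⟶ m) (h : m ⟶ f) :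
    glact g (ofGroupoid h : X.THom m f) = ofGroupoid (g ≫ h) := rfl

theorem glact_ofElt {e m f : G} (g : e ⟶ m) (x : X.Elt m f) :
    glact g (ofElt x) = ofElt (X.lact g x) := rfl

theorem ofGroupoid_injective {e f : G} {g h : e ⟶ f}
    (H : (ofGroupoid g : X.THom e f) = ofGroupoid h) : g = h := eq_of_heq (Sigma.mk.inj H).2

theorem ofElt_injective {e f : G} {x y : X.Elt e f} (H : ofElt x = ofElt y) : x = y :=
  eq_of_heq (Sigma.mk.inj H).2

/-- Every element of `T(X)` is obtained from an element of `G` by successive left multiplication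
by elements of `X`. -/
theorem cons_induction {f : G} {motive : ∀ e : G, X.THom e f → Prop}
    (unit : ∀ (e : G) (g : e ⟶ f), motive e (ofGroupoid g))
    (cons : ∀ (e m : G) (x : X.Elt e m) (t : X.THom m f), motive m t → motive e (cons x t))
    {e : G} (t : X.THom e f) : motive e t := by
  rcases t with ⟨n, t⟩
  induction n generalizing e with
  | zero => exact unit e t
  | succ n ih =>
    cases n with
    | zero =>
      -- Degree one is a separate clause of `tpow`, so an element of `X` is first written as its own
      -- product with an identity.
      have h := cons e f t (ofGroupoid (𝟙 f)) (unit f (𝟙 f))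
      have h' : THom.cons (X := X) t (ofGroupoid (𝟙 f)) = ofElt t :=
        (cons_ofGroupoid (X := X) t (𝟙 f)).trans (congrArg ofElt (X.ract_id t))
      exact Eq.mp (congrArg (motive e) h') h
    | succ n =>
      rcases t with ⟨p⟩
      exact cons e p.mid p.left ⟨n + 1, p.right⟩ (ih p.right)

theorem cons_fst {e m f : G} (x : X.Elt e m) (t : X.THom m f) : (cons x t).1 = t.1 + 1 := by
  rcases t with ⟨_ | n, t⟩ <;> rfl

theorem glact_fst {e m f : G} (g : e ⟶ m) (t : X.THom m f) : (glact g t).1 = t.1 := rfl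

theorem mul_fst {e m f : G} (t : X.THom e m) (s : X.THom m f) : (mul t s).1 = t.1 + s.1 := by
  induction t using cons_induction with
  | unit e g => exact (Nat.zero_add _).symm
  | cons e k x t ih => rw [cons_mul, cons_fst, cons_fst, ih]; omega

theorem glact_inv_glact {e m f : G} (g : e ⟶ m) (t : X.THom m f) :
    glact (Groupoid.inv g) (glact g t) = t := by
  rw [← comp_glact, Groupoid.inv_comp, id_glact]

theorem glact_glact_inv {e m f : G} (g : m ⟶ e) (t : X.THom m f) :
    glact g (glact (Groupoid.inv g) t) = t := by
  rw [← comp_glact, Groupoid.comp_inv, id_glact]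

/-- Two factorisations of an element of `T(X)` with leading factor in `X` differ by an element
of `G`. -/
theorem exists_of_cons_eq {e m m' f : G} {x : X.Elt e m} {x' : X.Elt e m'}
    {t : X.THom m f} {t' : X.THom m' f} (h : cons x t = cons x' t') :
    ∃ g : m ⟶ m', x' = X.ract x g ∧ t = glact g t' := by
  have hn : t.1 = t'.1 := by
    have := congrArg Sigma.fst h
    rw [cons_fst, cons_fst] at this
    omega
  obtain ⟨n, t⟩ := t
  obtain ⟨n', t'⟩ := t'
  obtain rfl : n = n' := hn
  -- Tails of degree zero are invertible, and `x t = x' t'` gives `x' = x (t t'⁻¹)`.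
  have (t : m ⟶ f) (t' : m' ⟶ f) (h : X.ract x t = X.ract x' t') :
      ∃ g : m ⟶ m', x' = X.ract x g ∧ (ofGroupoid t : X.THom m f) = glact g (ofGroupoid t') := by
    refine ⟨t ≫ Groupoid.inv t', ?_, ?_⟩
    · rw [X.ract_comp, h, ← X.ract_comp, Groupoid.comp_inv, X.ract_id]
    · rw [glact_ofGroupoid, Category.assoc, Groupoid.inv_comp, Category.comp_id]
  cases n with
  | zero =>
    exact this t t' (eq_of_heq (Sigma.mk.inj h).2)
  | succ n =>
    have h' : (tmul x t : (X.tensor (X.tpow (n + 1))).Elt e f) = tmul x' t' :=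
      eq_of_heq (Sigma.mk.inj h).2
    -- For longer tails the claim is the relation defining the tensor product, whose witness runs
    -- from `m'` to `m` and so has to be inverted.
    obtain ⟨g, h₁, h₂⟩ := _root_.Quotient.exact h'
    dsimp only at g h₁ h₂
    refine ⟨Groupoid.inv g, h₁, ?_⟩
    rw [h₂]
    exact (glact_inv_glact (X := X) g ⟨n + 1, t⟩).symm

theorem exists_zero_of_fst_eq_zero {e f : G} (t : X.THom e f) (h : t.1 = 0) :
    ∃ g : e ⟶ f, t = ofGroupoid g := by
  obtain ⟨n, t⟩ := t
  obtain rfl : n = 0 := h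
  exact ⟨t, rfl⟩

/-- After the common leading factor `x` is peeled off, the tails differ by a `g` with `x g = x`, and
freeness makes `g` an identity. -/
theorem mul_left_cancel (hX : ∀ ⦃e f : G⦄ (x : X.Elt e f) (g : f ⟶ f), X.ract x g = x → g = 𝟙 f)
    {e m f : G} (a : X.THom e m) (s t : X.THom m f) (h : mul a s = mul a t) : s = t := by
  induction a using cons_induction with
  | unit e g => simpa only [ofGroupoid_mul, glact_inv_glact] using congrArg (glact (Groupoid.inv g)) h
  | cons e k x a ih =>
    rw [cons_mul, cons_mul] at h
    obtain ⟨g, h₁, h₂⟩ := exists_of_cons_eq h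
    obtain rfl := hX x g h₁.symm
    rw [id_glact] at h₂
    exact ih h₂

/-- An element of degree zero is invertible and so divides anything on the left. Otherwise the
leading factors are `x` and `x g`; moving `g` into the tail of `b` leaves the same question for `a`
and `g b`. -/
theorem mul_right_rigid {e m m' f : G} (a : X.THom e m) (b : X.THom e m') (s : X.THom m f)
    (r : X.THom m' f) (h : mul a s = mul b r) : (∃ c, mul a c = b) ∨ ∃ c, mul b c = a := by
  induction a using cons_induction with
  | unit e g => exact .inl ⟨glact (Groupoid.inv g) b, glact_glact_inv g b⟩
  | cons e k x a ih =>
    cases b using cons_induction with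
    | unit e g => exact .inr ⟨glact (Groupoid.inv g) (cons x a), glact_glact_inv g _⟩
    | cons e k' x' b =>
      rw [cons_mul, cons_mul] at h
      obtain ⟨g, rfl, h₂⟩ := exists_of_cons_eq h
      rw [← glact_mul] at h₂
      rw [cons_ract]
      obtain ⟨c, hc⟩ | ⟨c, hc⟩ := ih _ h₂
      · exact .inl ⟨c, by rw [cons_mul, hc]⟩
      · exact .inr ⟨c, by rw [cons_mul, hc]⟩

/-- By degree, `s` and `t` lose leading factors in step until both lie in `G`. There `g z = g' z`,
so `g'⁻¹ g` fixes `z` and freeness on the left applies. -/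
theorem mul_ofElt_right_cancel
    (hX : ∀ ⦃e f : G⦄ (x : X.Elt e f) (g : e ⟶ e), X.lact g x = x → g = 𝟙 e)
    {e m f : G} (z : X.Elt m f) (s t : X.THom e m)
    (h : mul s (ofElt z) = mul t (ofElt z)) : s = t := by
  have hn : s.1 = t.1 := by
    have := congrArg Sigma.fst h
    rw [mul_fst, mul_fst] at this
    omega
  induction s using cons_induction with
  | unit e g =>
    obtain ⟨g', rfl⟩ := exists_zero_of_fst_eq_zero t hn.symm
    rw [ofGroupoid_mul, ofGroupoid_mul, glact_ofElt, glact_ofElt] at h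
    have h' := ofElt_injective h
    have h₁ : Groupoid.inv g' ≫ g = 𝟙 m := hX z _ (by
      rw [X.comp_lact, h', ← X.comp_lact, Groupoid.inv_comp, X.id_lact])
    rw [← Category.comp_id g', ← h₁, ← Category.assoc, Groupoid.comp_inv, Category.id_comp]
  | cons e k x s ih =>
    cases t using cons_induction with
    | unit e g => rw [cons_fst] at hn; cases hn
    | cons e k' x' t =>
      rw [cons_mul, cons_mul] at h
      obtain ⟨g, rfl, h₂⟩ := exists_of_cons_eq h
      rw [← glact_mul] at h₂
      rw [cons_fst, cons_fst] at hn
      rw [cons_ract, ih _ h₂ (by rw [glact_fst]; omega)]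

/-- `a` is a product of elements of `X` followed by an invertible element of `G`, and these are
cancelled one at a time from the right. -/
theorem mul_right_cancel
    (hX : ∀ ⦃e f : G⦄ (x : X.Elt e f) (g : e ⟶ e), X.lact g x = x → g = 𝟙 e)
    {e m f : G} (s t : X.THom e m) (a : X.THom m f) (h : mul s a = mul t a) : s = t := by
  induction a using cons_induction with
  | unit m g =>
    have h' := congrArg (mul · (ofGroupoid (Groupoid.inv g))) h
    simpa only [mul_assoc, ofGroupoid_mul, glact_ofGroupoid, Groupoid.comp_inv,
      mul_ofGroupoid_id] using h'
  | cons m k x a ih =>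
    rw [← ofElt_mul, ← mul_assoc, ← mul_assoc] at h
    exact mul_ofElt_right_cancel hX x s t (ih _ _ h)

end Bimodule.THom

/-! ### Transfer along fully faithful functors -/

section Transfer

variable {C : Type u} [Category.{u} C] {C' : Type u} [Category.{u} C']

theorem LeftCancellative.of_faithful (F : C ⥤ C') [F.Faithful] (h : LeftCancellative C') :
    LeftCancellative C := fun X Y Z a x y hxy =>
  F.map_injective (h (F.map a) _ _ (by rw [← F.map_comp, hxy, F.map_comp]))

theorem RightCancellative.of_faithful (F : C ⥤ C') [F.Faithful] (h : RightCancellative C') :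
    RightCancellative C := fun X Y Z x y a hxy =>
  F.map_injective (h _ _ (F.map a) (by rw [← F.map_comp, hxy, F.map_comp]))

theorem principalRightIdeal_comp_subset {X Y Z : C} (a : X ⟶ Y) (b : Y ⟶ Z) :
    principalRightIdeal (a ≫ b) ⊆ principalRightIdeal a := by
  rintro _ ⟨W, c, rfl⟩
  exact ⟨W, b ≫ c, by rw [Category.assoc]⟩

theorem mk_mem_principalRightIdeal {X Y : C} (a : X ⟶ Y) :
    Arrow.mk a ∈ principalRightIdeal a := ⟨Y, 𝟙 Y, by rw [Category.comp_id]⟩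

/-- A criterion for left Rees categories in terms of an additive length function. -/
theorem isLeftRees_of_length (hl : LeftCancellative C) (ℓ : ∀ {X Y : C}, (X ⟶ Y) → ℕ)
    (hadd : ∀ {X Y Z : C} (a : X ⟶ Y) (b : Y ⟶ Z), ℓ (a ≫ b) = ℓ a + ℓ b)
    (hiso : ∀ {X Y : C} (a : X ⟶ Y), ℓ a = 0 → IsIso a)
    (hr : ∀ {X Y Y' Z : C} (a : X ⟶ Y) (b : X ⟶ Y') (s : Y ⟶ Z) (r : Y' ⟶ Z),
      a ≫ s = b ≫ r → (∃ c, a ≫ c = b) ∨ ∃ c, b ≫ c = a) :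
    IsLeftRees C where
  leftCancellative := hl
  rightRigid := by
    rintro X Y X' Y' a b ⟨_, ⟨Z, s, rfl⟩, ⟨Z', r, h⟩⟩
    obtain ⟨rfl, rfl, h⟩ := (Arrow.mk_eq_mk_iff _ _).1 h
    obtain ⟨c, rfl⟩ | ⟨c, rfl⟩ := hr a b s r (by simpa using h)
    · exact .inr (principalRightIdeal_comp_subset a c)
    · exact .inl (principalRightIdeal_comp_subset b c)
  finite_above := by
    intro X Y a
    -- An ideal containing `aC` contains `a` itself, hence is generated by a left divisor of `a`.
    have key : ∀ I ∈ {I : Set (Arrow C) | (∃ (X' Y' : C) (b : X' ⟶ Y'),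
        I = principalRightIdeal b) ∧ principalRightIdeal a ⊂ I},
        ∃ (Y' : C) (b : X ⟶ Y') (c : Y' ⟶ Y), a = b ≫ c ∧ I = principalRightIdeal b := by
      rintro _ ⟨⟨X', Y', b, rfl⟩, h⟩
      obtain ⟨Z, c, hc⟩ := h.1 (mk_mem_principalRightIdeal a)
      obtain ⟨rfl, rfl, h⟩ := (Arrow.mk_eq_mk_iff _ _).1 hc
      exact ⟨Y', b, c, by simpa using h, rfl⟩
    choose Y' b c hbc hI using key
    rw [← Set.finite_coe_iff]
    -- Such a divisor has length between `0` and `ℓ a`. Two of them are comparable by `hr`; at equal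
    -- length the connecting factor `d` has length zero, so it is invertible and the ideals
    -- coincide.
    refine Finite.of_injective
      (fun I => (⟨ℓ (b I.1 I.2), Nat.lt_succ_of_le ?_⟩ : Fin (ℓ a + 1))) ?_
    · have := congrArg ℓ (hbc I.1 I.2)
      rw [hadd] at this
      omega
    · rintro ⟨I, h⟩ ⟨J, h'⟩ hIJ
      have hIJ : ℓ (b I h) = ℓ (b J h') := congrArg Fin.val hIJ
      refine Subtype.ext (?_ : I = J)
      rw [hI I h, hI J h']
      obtain ⟨d, hd⟩ | ⟨d, hd⟩ :=
        hr (b I h) (b J h') (c I h) (c J h') ((hbc I h).symm.trans (hbc J h'))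
      all_goals
        have h₀ := congrArg ℓ hd
        rw [hadd] at h₀
        have := hiso d (by omega)
        rw [← hd]
      · refine subset_antisymm ?_ (principalRightIdeal_comp_subset _ d)
        simpa using principalRightIdeal_comp_subset (b I h ≫ d) (inv d)
      · refine subset_antisymm (principalRightIdeal_comp_subset _ d) ?_
        simpa using principalRightIdeal_comp_subset (b J h' ≫ d) (inv d)

/-- Injectivity on objects is recorded because skeletality, unlike cancellation, does not pass along
a mere equivalence. -/
theorem IsomorphicCategories.exists_equivalence (h : IsomorphicCategories C C') :
    ∃ E : C ≌ C', Function.Injective E.functor.obj := by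
  obtain ⟨F, F', h, h'⟩ := h
  refine ⟨.mk F F' (eqToIso h.symm) (eqToIso h'), ?_⟩
  exact Function.LeftInverse.injective (g := F'.obj) fun X => Functor.congr_obj h X

theorem IsomorphicCategories.rightCancellative_iff (h : IsomorphicCategories C C') :
    RightCancellative C ↔ RightCancellative C' := by
  obtain ⟨E, -⟩ := h.exists_equivalence
  exact ⟨.of_faithful E.inverse, .of_faithful E.functor⟩

end Transfer

/-! ### Tensor categories as skeletal left Rees categories. -/

namespace Bimodule

variable {G : Type u} [Groupoid.{u} G] {X : Bimodule G}

theorem leftCancellative_tensorCategory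
    (hX : ∀ ⦃e f : G⦄ (x : X.Elt e f) (g : f ⟶ f), X.ract x g = x → g = 𝟙 f) :
    LeftCancellative X.TensorCategory := fun _ _ _ a x y h => THom.mul_left_cancel hX a x y h

theorem rightCancellative_tensorCategory
    (hX : ∀ ⦃e f : G⦄ (x : X.Elt e f) (g : e ⟶ e), X.lact g x = x → g = 𝟙 e) :
    RightCancellative X.TensorCategory := fun _ _ _ x y a h => THom.mul_right_cancel hX x y a h

/-- The degree of an arrow of `T(X)`. -/
def degree {e f : X.TensorCategory} (t : e ⟶ f) : ℕ := Sigma.fst t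

theorem degree_comp {e m f : X.TensorCategory} (t : e ⟶ m) (s : m ⟶ f) :
    degree (t ≫ s) = degree t + degree s := THom.mul_fst t s

theorem degree_id (e : X.TensorCategory) : degree (𝟙 e) = 0 := rfl

theorem exists_ofGroupoid_of_degree_eq_zero {e f : X.TensorCategory} (t : e ⟶ f)
    (h : degree t = 0) : ∃ g : Quiver.Hom (V := G) e f, t = THom.ofGroupoid g :=
  THom.exists_zero_of_fst_eq_zero t h

theorem isIso_of_degree_eq_zero {e f : X.TensorCategory} (t : e ⟶ f) (h : degree t = 0) :
    IsIso t := by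
  obtain ⟨g, rfl⟩ := exists_ofGroupoid_of_degree_eq_zero t h
  exact ⟨THom.ofGroupoid (Groupoid.inv g),
    congrArg THom.ofGroupoid (Groupoid.comp_inv (obj := G) g),
    congrArg THom.ofGroupoid (Groupoid.inv_comp (obj := G) g)⟩

/-- The degrees of an isomorphism and its inverse add up to zero, so isomorphisms of `T(X)` already
lie in `G`. -/
theorem skeletal_tensorCategory (hG : ∀ e f : G, (e ⟶ f) → e = f) :
    Skeletal X.TensorCategory := by
  rintro e f ⟨i⟩
  have h : degree i.hom = 0 := by
    have := congrArg degree i.hom_inv_id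
    rw [degree_comp, degree_id] at this
    omega
  obtain ⟨g, -⟩ := exists_ofGroupoid_of_degree_eq_zero i.hom h
  exact hG e f g

theorem isLeftRees_of_isomorphicCategories {C : Type u} [Category.{u} C]
    (hX : ∀ ⦃e f : G⦄ (x : X.Elt e f) (g : f ⟶ f), X.ract x g = x → g = 𝟙 f)
    (hC : IsomorphicCategories C X.TensorCategory) : IsLeftRees C := by
  obtain ⟨E, -⟩ := hC.exists_equivalence
  refine isLeftRees_of_length ((leftCancellative_tensorCategory hX).of_faithful E.functor)
    (fun a => degree (E.functor.map a)) ?_ ?_ ?_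
  · intro _ _ _ a b
    rw [E.functor.map_comp, degree_comp]
  · intro _ _ a h
    have := isIso_of_degree_eq_zero _ h
    exact isIso_of_reflects_iso a E.functor
  · intro _ _ _ _ a b s r h
    have h' : E.functor.map a ≫ E.functor.map s = E.functor.map b ≫ E.functor.map r := by
      rw [← E.functor.map_comp, h, E.functor.map_comp]
    obtain ⟨c, hc⟩ | ⟨c, hc⟩ := THom.mul_right_rigid _ _ _ _ h'
    · exact .inl ⟨E.functor.preimage c, E.functor.map_injective (by
        rw [E.functor.map_comp, E.functor.map_preimage]; exact hc)⟩
    · exact .inr ⟨E.functor.preimage c, E.functor.map_injective (by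
        rw [E.functor.map_comp, E.functor.map_preimage]; exact hc)⟩

theorem skeletal_of_isomorphicCategories {C : Type u} [Category.{u} C]
    (hG : ∀ e f : G, (e ⟶ f) → e = f)
    (hC : IsomorphicCategories C X.TensorCategory) : Skeletal C := by
  obtain ⟨E, hE⟩ := hC.exists_equivalence
  rintro Y Z ⟨i⟩
  exact hE (skeletal_tensorCategory hG ⟨E.functor.mapIso i⟩)

end Bimodule

end ReesCat

namespace ReesCat

/-! ### Functors out of `T(X)`. -/

namespace Bimodule

variable {G : Type u} [Groupoid.{u} G] {X : Bimodule G} {C : Type u} [Category.{u} C]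

/-- A functor from `G` to a category `C` together with a compatible map from `X` to the arrows
of `C`. -/
structure Representation (X : Bimodule G) (C : Type u) [Category.{u} C] where
  functor : G ⥤ C
  map : ∀ {e f : G}, X.Elt e f → (functor.obj e ⟶ functor.obj f)
  map_lact : ∀ {e' e f : G} (g : e' ⟶ e) (x : X.Elt e f),
    map (X.lact g x) = functor.map g ≫ map x
  map_ract : ∀ {e f f' : G} (x : X.Elt e f) (g : f ⟶ f'),
    map (X.ract x g) = map x ≫ functor.map g

namespace Representation

variable (R : Representation X C)

/-- The extension of a representation of `X` to each tensor power. -/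
def tpowMap (f : G) : ∀ n : ℕ,
    {E : ∀ e : G, (X.tpow n).Elt e f → (R.functor.obj e ⟶ R.functor.obj f) //
      ∀ (e' e : G) (g : e' ⟶ e) (t : (X.tpow n).Elt e f),
        E e' ((X.tpow n).lact g t) = R.functor.map g ≫ E e t}
  | 0 => ⟨fun _ g => R.functor.map g, fun _ _ g h => R.functor.map_comp g h⟩
  | 1 => ⟨fun _ x => R.map x, fun _ _ g x => R.map_lact g x⟩
  | n + 2 =>
    ⟨fun e => _root_.Quotient.lift
        (fun p : Pair X (X.tpow (n + 1)) e f =>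
          R.map p.left ≫ (tpowMap f (n + 1)).1 p.mid p.right)
        (by
          rintro ⟨a, x, y⟩ ⟨b, x', y'⟩ ⟨g, h₁, h₂⟩
          dsimp only at g h₁ h₂ ⊢
          -- The factor `g⁻¹` from the left entry meets the `g` that equivariance extracts from the
          -- right entry; this is why the recursion carries equivariance along.
          rw [h₁, h₂, (tpowMap f (n + 1)).2, R.map_ract, Category.assoc,
            ← Category.assoc (R.functor.map (Groupoid.inv g)), ← R.functor.map_comp,
            Groupoid.inv_comp, R.functor.map_id, Category.id_comp]),
      by
        rintro e' e g ⟨p⟩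
        exact (congrArg (· ≫ (tpowMap f (n + 1)).1 p.mid p.right) (R.map_lact g p.left)).trans
          (Category.assoc _ _ _)⟩

/-- The extension of a representation of `X` to `T(X)`. -/
def extend {e f : G} (t : X.THom e f) : R.functor.obj e ⟶ R.functor.obj f :=
  (R.tpowMap f t.1).1 e t.2

theorem extend_ofGroupoid {e f : G} (g : e ⟶ f) :
    R.extend (THom.ofGroupoid g) = R.functor.map g := rfl

theorem extend_glact {e m f : G} (g : e ⟶ m) (t : X.THom m f) :
    R.extend (THom.glact g t) = R.functor.map g ≫ R.extend t := (R.tpowMap f t.1).2 e m g t.2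

theorem extend_cons {e m f : G} (x : X.Elt e m) (t : X.THom m f) :
    R.extend (THom.cons x t) = R.map x ≫ R.extend t := by
  rcases t with ⟨_ | n, t⟩
  · exact R.map_ract x t
  · rfl

theorem extend_mul {e m f : G} (t : X.THom e m) (s : X.THom m f) :
    R.extend (THom.mul t s) = R.extend t ≫ R.extend s := by
  induction t using THom.cons_induction with
  | unit e g => rw [THom.ofGroupoid_mul, extend_glact, extend_ofGroupoid]
  | cons e k x t ih => rw [THom.cons_mul, extend_cons, extend_cons, ih, Category.assoc]

/-- The functor from the tensor category induced by a representation of `X`. -/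
def tensorFunctor : X.TensorCategory ⥤ C where
  obj e := R.functor.obj e
  map t := R.extend t
  map_id e := R.functor.map_id e
  map_comp t s := R.extend_mul t s

end Representation

end Bimodule

/-! ### The isomorphism between `⟨D⟩` and `T(B(D))`. -/

namespace PartialHomDiagram

open Bimodule

variable (D : PartialHomDiagram.{u})

/-- The object of `⟨D⟩` at a vertex. -/
def vertexObj (e : D.V) : D.PresentedCategory :=
  (Quotient.functor D.Rel).obj ((Paths.of D.Aug).obj e)

/-- The arrow of `⟨D⟩` given by an element of a vertex group. -/
def loopHom {e : D.V} (g : D.Grp e) : D.vertexObj e ⟶ D.vertexObj e :=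
  (Quotient.functor D.Rel).map (D.loopArrow g)

/-- The arrow of `⟨D⟩` given by an edge. -/
def edgeHom {e f : D.V} (x : D.Edge e f) : D.vertexObj e ⟶ D.vertexObj f :=
  (Quotient.functor D.Rel).map (D.edgeArrow x)

theorem loopHom_one (e : D.V) : D.loopHom (1 : D.Grp e) = 𝟙 (D.vertexObj e) :=
  (CategoryTheory.Quotient.sound D.Rel (.one e)).trans ((Quotient.functor D.Rel).map_id _)

theorem loopHom_mul {e : D.V} (g h : D.Grp e) :
    D.loopHom (g * h) = D.loopHom g ≫ D.loopHom h :=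
  (CategoryTheory.Quotient.sound D.Rel (.mul g h)).symm.trans
    ((Quotient.functor D.Rel).map_comp _ _)

theorem loopHom_edgeHom {e f : D.V} (x : D.Edge e f) (g : D.dom x) :
    D.loopHom (g : D.Grp e) ≫ D.edgeHom x = D.edgeHom x ≫ D.loopHom (D.φ x g : D.Grp f) :=
  ((Quotient.functor D.Rel).map_comp _ _).symm.trans
    ((CategoryTheory.Quotient.sound D.Rel (.edge x g)).trans
      ((Quotient.functor D.Rel).map_comp _ _))

/-- The arrow of `⟨D⟩` given by an arrow of the vertex groupoid. -/
def vertexHom {e f : D.V} : D.Loop e f → (D.vertexObj e ⟶ D.vertexObj f)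
  | .mk g => D.loopHom g

/-- The inclusion of the vertex groupoid into `⟨D⟩`. -/
def vertexFunctor : D.VertexGroupoid ⥤ D.PresentedCategory where
  obj e := D.vertexObj e
  map a := D.vertexHom a
  map_id e := D.loopHom_one e
  map_comp := by
    rintro _ _ _ ⟨g⟩ ⟨h⟩
    exact D.loopHom_mul g h

/-- The arrow `g ≫ x ≫ h` of `⟨D⟩`. -/
def tripleHom {e f : D.V} (p : D.Triple e f) : D.vertexObj e ⟶ D.vertexObj f :=
  D.loopHom p.g ≫ D.edgeHom p.x ≫ D.loopHom p.h

/-- With `g₁ = g₂ (g₂⁻¹ g₁)`, the second factor slides through the edge and becomes `h₂ h₁⁻¹`, which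
turns `h₁` into `h₂`. -/
theorem tripleHom_eq {e f : D.V} {p q : D.Triple e f} (h : tripleSetoid D e f p q) :
    D.tripleHom p = D.tripleHom q := by
  obtain ⟨g₁, x, h₁⟩ := p
  obtain ⟨g₂, x₂, h₂⟩ := q
  obtain ⟨h, hg, hφ⟩ := h
  dsimp only at h hg hφ
  subst h
  have key := D.loopHom_edgeHom x ⟨g₂⁻¹ * g₁, hg⟩
  dsimp only [tripleHom]
  rw [hφ] at key
  have h₃ : g₁ = g₂ * (g₂⁻¹ * g₁) := by simp
  have h₄ : h₂ = (h₂ * h₁⁻¹) * h₁ := by simp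
  rw [h₃, h₄, D.loopHom_mul g₂, D.loopHom_mul _ h₁, Category.assoc,
    ← Category.assoc (D.loopHom (g₂⁻¹ * g₁)), key, Category.assoc]

/-- The tautological representation of `B(D)` in `⟨D⟩`. -/
def representation : Representation D.coveringBimodule.toBimodule D.PresentedCategory where
  functor := D.vertexFunctor
  map := _root_.Quotient.lift D.tripleHom fun _ _ h => D.tripleHom_eq h
  map_lact := by
    rintro e' e f ⟨g⟩ ⟨p⟩
    exact (congrArg (· ≫ _) (D.loopHom_mul g p.g)).trans (Category.assoc _ _ _)
  map_ract := by
    rintro e f f' ⟨p⟩ ⟨g⟩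
    refine (congrArg (D.loopHom p.g ≫ D.edgeHom p.x ≫ ·) (D.loopHom_mul p.h g)).trans ?_
    exact ((Category.assoc _ _ _).trans (congrArg _ (Category.assoc _ _ _))).symm

/-- The class `[g, x, h]` in `B(D)`. -/
def triple {e f : D.V} (g : D.Grp e) (x : D.Edge e f) (h : D.Grp f) :
    D.coveringBimodule.Elt e f := _root_.Quotient.mk (D.tripleSetoid e f) ⟨g, x, h⟩

theorem triple_eq_iff {e f : D.V} {g g' : D.Grp e} {x : D.Edge e f} {h h' : D.Grp f} :
    D.triple g x h = D.triple g' x h' ↔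
      ∃ hg : g'⁻¹ * g ∈ D.dom x, (D.φ x ⟨g'⁻¹ * g, hg⟩ : D.Grp f) = h' * h⁻¹ :=
  ⟨fun H => (_root_.Quotient.exact H).2,
    fun H => _root_.Quotient.sound (s := D.tripleSetoid e f) ⟨rfl, H⟩⟩

/-- The arrow of `T(B(D))` given by an edge of `D'`. -/
def augHom {e f : D.V} : D.AugEdge e f → D.coveringBimodule.toBimodule.THom e f
  | .edge x => THom.ofElt (D.triple 1 x 1)
  | .loop g => THom.ofGroupoid (Loop.mk g)

/-- The functor from the free category on `D'` to `T(B(D))`. -/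
def pathFunctor : Paths D.Aug ⥤ D.coveringBimodule.toBimodule.TensorCategory :=
  Paths.lift { obj := fun e => e, map := fun a => D.augHom a }

theorem pathFunctor_map_of {e f : D.Aug} (a : e ⟶ f) :
    D.pathFunctor.map ((Paths.of D.Aug).map a) = D.augHom a := Paths.lift_toPath _ a

theorem pathFunctor_map_comp {e k f : Paths D.Aug} (a : e ⟶ k) (b : k ⟶ f) :
    D.pathFunctor.map (a ≫ b) = THom.mul (D.pathFunctor.map a) (D.pathFunctor.map b) :=
  D.pathFunctor.map_comp a b

theorem pathFunctor_map_eq {e f : Paths D.Aug} {a b : e ⟶ f} (h : D.Rel a b) :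
    D.pathFunctor.map a = D.pathFunctor.map b := by
  cases h with
  | one e => exact (D.pathFunctor_map_of _).trans (D.pathFunctor.map_id _).symm
  | mul g h =>
    refine (D.pathFunctor_map_comp _ _).trans ?_
    exact (congrArg₂ THom.mul (D.pathFunctor_map_of _) (D.pathFunctor_map_of _)).trans
      (D.pathFunctor_map_of (AugEdge.loop (g * h))).symm
  | edge x g =>
    refine (D.pathFunctor_map_comp _ _).trans (Eq.trans ?_ (D.pathFunctor_map_comp _ _).symm)
    refine (congrArg₂ THom.mul (D.pathFunctor_map_of _) (D.pathFunctor_map_of _)).trans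
      (Eq.trans ?_ (congrArg₂ THom.mul (D.pathFunctor_map_of _) (D.pathFunctor_map_of _)).symm)
    -- This is the only relation that involves the identifications in `B(D)`: it says `[g, x, 1] =
    -- [1, x, φ_x(g)]`.
    refine congrArg THom.ofElt (?_ : D.triple ((g : D.Grp _) * 1) x 1 =
      D.triple 1 x (1 * (D.φ x g : D.Grp _)))
    rw [triple_eq_iff]
    simp

/-- The functor from `⟨D⟩` to `T(B(D))`. -/
def toTensorCategory : D.PresentedCategory ⥤ D.coveringBimodule.toBimodule.TensorCategory :=
  CategoryTheory.Quotient.lift D.Rel D.pathFunctor fun _ _ _ _ h => D.pathFunctor_map_eq h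

/-- The functor from `T(B(D))` to `⟨D⟩`. -/
def fromTensorCategory : D.coveringBimodule.toBimodule.TensorCategory ⥤ D.PresentedCategory :=
  D.representation.tensorFunctor

theorem toTensorCategory_map_loopHom {e : D.V} (g : D.Grp e) :
    D.toTensorCategory.map (D.loopHom g) = THom.ofGroupoid (Loop.mk g) :=
  D.pathFunctor_map_of _

theorem toTensorCategory_map_edgeHom {e f : D.V} (x : D.Edge e f) :
    D.toTensorCategory.map (D.edgeHom x) = THom.ofElt (D.triple 1 x 1) :=
  D.pathFunctor_map_of _

theorem representation_map_triple {e f : D.V} (g : D.Grp e) (x : D.Edge e f) (h : D.Grp f) :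
    D.representation.map (D.triple g x h) = D.loopHom g ≫ D.edgeHom x ≫ D.loopHom h := rfl

theorem representation_map_triple_one {e f : D.V} (x : D.Edge e f) :
    D.representation.map (D.triple 1 x 1) = D.edgeHom x := by
  rw [representation_map_triple, loopHom_one, loopHom_one]
  exact (Category.id_comp _).trans (Category.comp_id _)

theorem toTensorCategory_map_comp {a b c : D.PresentedCategory} (s : a ⟶ b) (t : b ⟶ c) :
    D.toTensorCategory.map (s ≫ t) =
      THom.mul (D.toTensorCategory.map s) (D.toTensorCategory.map t) :=
  D.toTensorCategory.map_comp s t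

theorem triple_mul_one_one_mul {e f : D.V} (g : D.Grp e) (x : D.Edge e f) (h : D.Grp f) :
    D.triple (g * 1) x (1 * h) = D.triple g x h := by
  rw [mul_one, one_mul]

theorem toTensorCategory_map_representation_map {e f : D.VertexGroupoid}
    (x : D.coveringBimodule.Elt e f) :
    D.toTensorCategory.map (D.representation.map x) = THom.ofElt x := by
  rcases x with ⟨⟨g, x, h⟩⟩
  refine (D.toTensorCategory_map_comp _ _).trans ?_
  refine (congrArg₂ THom.mul (D.toTensorCategory_map_loopHom g)
    ((D.toTensorCategory_map_comp _ _).trans (congrArg₂ THom.mul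
      (D.toTensorCategory_map_edgeHom x) (D.toTensorCategory_map_loopHom h)))).trans ?_
  exact congrArg THom.ofElt (D.triple_mul_one_one_mul g x h)

theorem toTensorCategory_map_extend {e f : D.VertexGroupoid}
    (t : D.coveringBimodule.THom e f) :
    D.toTensorCategory.map (D.representation.extend t) = t := by
  induction t using THom.cons_induction with
  | unit e g =>
    obtain ⟨g⟩ := g
    exact D.toTensorCategory_map_loopHom g
  | cons e m x t ih =>
    rw [Representation.extend_cons]
    refine (D.toTensorCategory_map_comp _ _).trans ?_
    exact congrArg₂ THom.mul (D.toTensorCategory_map_representation_map x) ih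

/-- Functors out of a quotient of a path category are determined by their values on the edges of
`D'`. -/
theorem toTensorCategory_comp_fromTensorCategory :
    D.toTensorCategory ⋙ D.fromTensorCategory = 𝟭 D.PresentedCategory := by
  refine CategoryTheory.Quotient.lift_unique' D.Rel _ _ (Paths.ext_functor rfl ?_)
  intro e f a
  refine Eq.trans (?_ : _ = (Quotient.functor D.Rel).map ((Paths.of D.Aug).map a)) ?_
  · refine (congrArg D.fromTensorCategory.map (D.pathFunctor_map_of a)).trans ?_
    obtain x | g := a
    · exact D.representation_map_triple_one x
    · rfl
  -- The identities on both sides are the object transports of `Paths.ext_functor`, trivial here.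
  · exact ((Category.id_comp _).trans (Category.comp_id _)).symm

theorem fromTensorCategory_comp_toTensorCategory :
    D.fromTensorCategory ⋙ D.toTensorCategory =
      𝟭 D.coveringBimodule.toBimodule.TensorCategory :=
  Functor.hext (fun _ => rfl) fun _ _ t => heq_of_eq (D.toTensorCategory_map_extend t)

theorem isomorphicCategories_tensorCategory :
    IsomorphicCategories D.PresentedCategory D.coveringBimodule.toBimodule.TensorCategory :=
  ⟨_, _, D.toTensorCategory_comp_fromTensorCategory, D.fromTensorCategory_comp_toTensorCategory⟩

/-! ### Right cancellation and injectivity of the `φ_x`. -/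

theorem eq_one_of_triple_mul_eq (hD : D.IsPartialIso) {e f : D.V} (g k : D.Grp e)
    (x : D.Edge e f) (l : D.Grp f) (h : D.triple (g * k) x l = D.triple k x l) : g = 1 := by
  obtain ⟨hg, hφ⟩ := D.triple_eq_iff.1 h
  rw [mul_inv_cancel, OneMemClass.coe_eq_one] at hφ
  have h₁ : k⁻¹ * (g * k) = 1 :=
    congrArg Subtype.val ((hD x).1 (hφ.trans (map_one _).symm))
  simpa [inv_mul_eq_one] using h₁

/-- If `g` fixes `[k, x, l]`, then `k⁻¹ g k` lies in the kernel of `φ_x`, which is trivial. -/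
theorem lact_free_of_isPartialIso (hD : D.IsPartialIso) ⦃e f : D.VertexGroupoid⦄
    (x : D.coveringBimodule.Elt e f) (g : e ⟶ e) (h : D.coveringBimodule.lact g x = x) :
    g = 𝟙 e := by
  rcases x with ⟨⟨k, x, l⟩⟩
  obtain ⟨g⟩ := g
  exact congrArg Loop.mk (D.eq_one_of_triple_mul_eq hD g k x l h)

/-- If `φ_x(a) = φ_x(b)`, then `a x = x φ_x(a) = b x`, and `x` cancels on the right. -/
theorem isPartialIso_of_rightCancellative
    (h : RightCancellative D.coveringBimodule.toBimodule.TensorCategory) : D.IsPartialIso := by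
  refine fun e f x => ⟨fun a b hab => ?_, D.φ_surjective x⟩
  have key : D.triple ((a : D.Grp e) * 1) x 1 = D.triple ((b : D.Grp e) * 1) x 1 := by
    rw [triple_eq_iff]
    have hm : ((b : D.Grp e) * 1)⁻¹ * (a * 1) = (b⁻¹ * a : D.dom x) := by simp
    refine ⟨hm ▸ (b⁻¹ * a).2, ?_⟩
    have : (⟨_, hm ▸ (b⁻¹ * a).2⟩ : D.dom x) = b⁻¹ * a := Subtype.ext hm
    rw [this, map_mul, map_inv, hab]
    simp
  have := THom.ofGroupoid_injective (X := D.coveringBimodule.toBimodule)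
    (h (THom.ofGroupoid (Loop.mk (a : D.Grp e))) (THom.ofGroupoid (Loop.mk (b : D.Grp e)))
      (THom.ofElt (D.triple 1 x 1)) (congrArg THom.ofElt key))
  injection this with h'
  exact Subtype.ext h'

theorem rightCancellative_presentedCategory_iff :
    RightCancellative D.PresentedCategory ↔ D.IsPartialIso :=
  D.isomorphicCategories_tensorCategory.rightCancellative_iff.trans
    ⟨D.isPartialIso_of_rightCancellative,
      fun hD => rightCancellative_tensorCategory (D.lact_free_of_isPartialIso hD)⟩

theorem skeletal_presentedCategory : Skeletal D.PresentedCategory := by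
  refine skeletal_of_isomorphicCategories ?_ D.isomorphicCategories_tensorCategory
  rintro e _ ⟨g⟩
  rfl

theorem isLeftRees_presentedCategory : IsLeftRees D.PresentedCategory :=
  isLeftRees_of_isomorphicCategories (fun _ _ x g h => D.coveringBimodule.right_free x g h)
    D.isomorphicCategories_tensorCategory

end PartialHomDiagram

end ReesCat

theorem mainTheorem3 (D : ReesCat.PartialHomDiagram.{u}) :
    (Skeletal D.PresentedCategory ∧ ReesCat.IsLeftRees D.PresentedCategory) ∧
    ReesCat.IsomorphicCategories D.PresentedCategory
      D.coveringBimodule.toBimodule.TensorCategory ∧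
    ((Skeletal D.PresentedCategory ∧ ReesCat.IsRees D.PresentedCategory) ↔
      D.IsPartialIso) :=
  ⟨⟨D.skeletal_presentedCategory, D.isLeftRees_presentedCategory⟩,
    D.isomorphicCategories_tensorCategory,
    fun h => D.rightCancellative_presentedCategory_iff.1 h.2.rightCancellative,
    fun h => ⟨D.skeletal_presentedCategory,
      ⟨D.isLeftRees_presentedCategory, D.rightCancellative_presentedCategory_iff.2 h⟩⟩⟩
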